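/- Let $\mathcal{G}$ be a connected, simple, undirected weighted graph on the nodes $1,\dots,N$ with symmetric nonnegative adjacency matrix $[a_{ij}]$ (zero diagonal; $\{i,j\}$ is an edge iff $a_{ij}>0$), and let $L=\mathrm{diag}\bigl(\sum_j a_{1j},\dots,\sum_j a_{Nj}\bigr)-[a_{ij}]$ be its Laplacian, with eigenvalues $0=\lambda_1<\lambda_2\le\dots\le\lambda_N$ counted with multiplicity. Let $R\in\mathbb{R}^{N\times K}$ be an incidence matrix of $\mathcal{G}$ (one column for each of the $K$ undirected edges, with entries $1$ and $-1$ at the two end points of that edge, in either order, and $0$ elsewhere), and let $W$ be the $K\times K$ diagonal matrix of the corresponding edge weights. Consider $N$ identical agents $$\dot x_i=Ax_i+Bu_i+Ed_i,\qquad y_i=C_1x_i+D_1d_i,\qquad z_i=C_2x_i+D_2u_i,\qquad i=1,\dots,N,$$ with $x_i\in\mathbb{R}^n$, $u_i\in\mathbb{R}^m$, $d_i\in\mathbb{R}^q$, $y_i\in\mathbb{R}^r$, $z_i\in\mathbb{R}^p$. For gains $F\in\mathbb{R}^{m\times n}$ and $G\in\mathbb{R}^{n\times r}$ interconnect them by the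 distributed protocol $$\dot w_i=Aw_i+B\sum_{j=1}^N a_{ij}(u_i-u_j)+G\Bigl(\sum_{j=1}^N a_{ij}(y_i-y_j)-C_1w_i\Bigr),\qquad u_i=Fw_i .$$ The protocol is said to synchronize the network if, whenever all $d_i$ are $0$, $x_i(t)-x_j(t)\to0$ and $w_i(t)-w_j(t)\to0$ as $t\to\infty$ for all $i,j$. Put $$A_e=\begin{pmatrix}I_N\otimes A&I_N\otimes BF\\ L\otimes GC_1&I_N\otimes(A-GC_1)+L\otimes BF\end{pmatrix},\quad E_e=\begin{pmatrix}I_N\otimes E\\ L\otimes GD_1\end{pmatrix},\quad C_e=\begin{pmatrix}W^{1/2}R^\top\otimes C_2&W^{1/2}R^\top\otimes D_2F\end{pmatrix},$$ and let $$J(F,G)=\int_0^\infty \mathrm{tr}\bigl[T(t)^\top T(t)\bigr]\,dt\in[0,\infty],\qquad T(t)=C_ee^{A_et}E_e .$$ For $i=2,\dots,N$ consider the auxiliary system $$\dot\xi_i=A\xi_i+\lambda_iBv_i+E\delta_i,\qquad \vartheta_i=C_1\xi_i+D_1\delta_i,\qquad \eta_i=\sqrt{\lambda_i}\,C_2\xi_i+\lambda_i\sqrt{\lambda_i}\,D_2v_i$$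 with the controller $$\dot\omega_i=A\omega_i+\lambda_iBv_i+G(\vartheta_i-C_1\omega_i),\qquad v_i=F\omega_i .$$ Their closed loop has the matrices $$\bar A_i=\begin{pmatrix}A&\lambda_iBF\\ GC_1&A-GC_1+\lambda_iBF\end{pmatrix},\quad \bar E_i=\begin{pmatrix}E\\ GD_1\end{pmatrix},\quad \bar C_i=\begin{pmatrix}\sqrt{\lambda_i}\,C_2&\lambda_i\sqrt{\lambda_i}\,D_2F\end{pmatrix}.$$ The controller internally stabilizes the system if all eigenvalues of $\bar A_i$ have negative real part. Let $$J_i(F,G)=\int_0^\infty \mathrm{tr}\bigl[T_i(t)^\top T_i(t)\bigr]\,dt\in[0,\infty],\qquad T_i(t)=\bar C_ie^{\bar A_it}\bar E_i .$$ Then, for all $F\in\mathbb{R}^{m\times n}$ and $G\in\mathbb{R}^{n\times r}$, the protocol with gains $F,G$ synchronizes the network if and only if, for each $i=2,\dots,N$, the controller with gains $F,G$ internally stabilizes the $i$-th auxiliary system. Moreover, $$J(F,G)=\sum_{i=2}^N J_i(F,G).$$ -/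

import Mathlib

open Filter Topology MeasureTheory
open scoped Matrix Kronecker ENNReal

namespace MultiAgent

/-! ### Weighted graphs -/

/-- A simple undirected weighted graph on the nodes `Fin N`, given by its adjacency matrix
`[a i j]`: nonnegative symmetric weights and zero diagonal.  The pair `{i, j}` is an edge
exactly when `0 < a i j`. -/
structure WeightedGraph (N : ℕ) where
  a : Matrix (Fin N) (Fin N) ℝ
  nonneg : ∀ i j, 0 ≤ a i j
  symm : ∀ i j, a i j = a j i
  loopless : ∀ i, a i i = 0

namespace WeightedGraph

variable {N : ℕ}

/-- The underlying unweighted graph. -/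
def toSimpleGraph (Γ : WeightedGraph N) : SimpleGraph (Fin N) where
  Adj i j := 0 < Γ.a i j
  symm := ⟨fun i j h => by rw [Γ.symm j i]; exact h⟩
  loopless := ⟨fun i h => by rw [Γ.loopless i] at h; exact lt_irrefl _ h⟩

/-- The Laplacian matrix: degree matrix minus adjacency matrix. -/
def laplacian (Γ : WeightedGraph N) : Matrix (Fin N) (Fin N) ℝ :=
  Matrix.diagonal (fun i => ∑ j, Γ.a i j) - Γ.a

/-- `R` is an incidence matrix of the graph and `ω` is the accompanying list of edge weights:
there is a numbering `e` of the (undirected) edges by `Fin K` such that column `k` of `R` has one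
entry `1` and one entry `-1`, at the two end points of the edge `e k`, and zeros elsewhere, and
such that `ω k` is the weight of the edge `e k`.  The orientation of each edge is arbitrary. -/
def IsIncidence (Γ : WeightedGraph N) {K : ℕ} (R : Matrix (Fin N) (Fin K) ℝ) (ω : Fin K → ℝ) :
    Prop :=
  ∃ e : Fin K ≃ Γ.toSimpleGraph.edgeSet, ∀ k, ∃ i j : Fin N,
    (e k : Sym2 (Fin N)) = s(i, j) ∧ R i k = 1 ∧ R j k = -1 ∧
      (∀ l, l ≠ i → l ≠ j → R l k = 0) ∧ ω k = Γ.a i j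

end WeightedGraph

/-- `lam 0 ≤ lam 1 ≤ ⋯` are the eigenvalues, with multiplicities, of the real symmetric matrix
`M`: some orthogonal matrix `U` satisfies `Uᵀ M U = diag(lam)`. -/
def IsOrderedSpectrum {N : ℕ} (M : Matrix (Fin N) (Fin N) ℝ) (lam : Fin N → ℝ) : Prop :=
  Monotone lam ∧
    ∃ U ∈ Matrix.orthogonalGroup (Fin N) ℝ, Uᵀ * M * U = Matrix.diagonal lam

/-! ### Linear systems, Hurwitz matrices, the `H₂` cost -/

/-- The coefficient matrices of a linear system
`ẋ = A x + B u + E d`, `y = C₁ x + D₁ d`, `z = C₂ x + D₂ u`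
with state in `ℝⁿ`, input in `ℝᵐ`, disturbance in `ℝ^q`, measured output in `ℝʳ` and output to be
controlled in `ℝᵖ`. -/
structure LinSys (n m q r p : ℕ) where
  A : Matrix (Fin n) (Fin n) ℝ
  B : Matrix (Fin n) (Fin m) ℝ
  E : Matrix (Fin n) (Fin q) ℝ
  C₁ : Matrix (Fin r) (Fin n) ℝ
  D₁ : Matrix (Fin r) (Fin q) ℝ
  C₂ : Matrix (Fin p) (Fin n) ℝ
  D₂ : Matrix (Fin p) (Fin m) ℝ

/-- A real square matrix is Hurwitz if all its complex eigenvalues have negative real part. -/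
def IsHurwitz {ι : Type*} [Fintype ι] [DecidableEq ι] (M : Matrix ι ι ℝ) : Prop :=
  ∀ μ ∈ spectrum ℂ (M.map (algebraMap ℝ ℂ)), μ.re < 0

/-- The impulse response `T(t) = C e^{A t} E`. -/
noncomputable def impulseResponse {ι κ θ : Type*} [Fintype ι] [DecidableEq ι]
    (A : Matrix ι ι ℝ) (E : Matrix ι κ ℝ) (C : Matrix θ ι ℝ) (t : ℝ) : Matrix θ κ ℝ :=
  C * NormedSpace.exp (t • A) * E

/-- The squared `L₂`-norm `∫₀^∞ tr (T(t)ᵀ T(t)) dt` of the impulse response, as an element of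
`[0, ∞]`. -/
noncomputable def h2Cost {ι κ θ : Type*} [Fintype ι] [DecidableEq ι] [Fintype κ] [Fintype θ]
    (A : Matrix ι ι ℝ) (E : Matrix ι κ ℝ) (C : Matrix θ ι ℝ) : ℝ≥0∞ :=
  ∫⁻ t in Set.Ici (0 : ℝ),
    ENNReal.ofReal (((impulseResponse A E C t)ᵀ * impulseResponse A E C t).trace)

namespace LinSys

variable {n m q r p : ℕ}

/-! The observer based controller `ẇ = A w + B u + G (y - C₁ w)`, `u = F w`, and its
interconnection with the system. -/

/-- The state matrix of the closed loop, in the state `(x, w)`. -/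
def closedA (S : LinSys n m q r p) (F : Matrix (Fin m) (Fin n) ℝ) (G : Matrix (Fin n) (Fin r) ℝ) :
    Matrix (Fin n ⊕ Fin n) (Fin n ⊕ Fin n) ℝ :=
  Matrix.fromBlocks S.A (S.B * F) (G * S.C₁) (S.A + S.B * F - G * S.C₁)

/-- The disturbance matrix of the closed loop. -/
def closedE (S : LinSys n m q r p) (G : Matrix (Fin n) (Fin r) ℝ) :
    Matrix (Fin n ⊕ Fin n) (Fin q) ℝ :=
  Matrix.fromRows S.E (G * S.D₁)

/-- The matrix of the controlled output `z` of the closed loop. -/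
def closedC (S : LinSys n m q r p) (F : Matrix (Fin m) (Fin n) ℝ) :
    Matrix (Fin p) (Fin n ⊕ Fin n) ℝ :=
  Matrix.fromCols S.C₂ (S.D₂ * F)

/-- The observer based controller with gains `F`, `G` internally stabilizes the system: the
closed loop state matrix is Hurwitz. -/
def InternallyStabilizes (S : LinSys n m q r p) (F : Matrix (Fin m) (Fin n) ℝ)
    (G : Matrix (Fin n) (Fin r) ℝ) : Prop :=
  IsHurwitz (S.closedA F G)

/-- The `H₂` cost of the closed loop, from the disturbance `d` to the output `z`. -/
noncomputable def cost (S : LinSys n m q r p) (F : Matrix (Fin m) (Fin n) ℝ)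
    (G : Matrix (Fin n) (Fin r) ℝ) : ℝ≥0∞ :=
  h2Cost (S.closedA F G) (S.closedE G) (S.closedC F)

/-- The auxiliary system attached to an eigenvalue `l`:
`ξ' = A ξ + l B v + E δ`, `ϑ = C₁ ξ + D₁ δ`, `η = √l C₂ ξ + l √l D₂ v`. -/
noncomputable def auxiliary (S : LinSys n m q r p) (l : ℝ) : LinSys n m q r p where
  A := S.A
  B := l • S.B
  E := S.E
  C₁ := S.C₁
  D₁ := S.D₁
  C₂ := Real.sqrt l • S.C₂
  D₂ := (l * Real.sqrt l) • S.D₂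

/-! ### The network -/

variable {N : ℕ}

/-- The functions `x`, `w`, `u`, `y` of time `t ≥ 0` are trajectories of the `N` agents
`ẋᵢ = A xᵢ + B uᵢ + E dᵢ`, `yᵢ = C₁ xᵢ + D₁ dᵢ`, interconnected by the distributed protocol
`ẇᵢ = A wᵢ + B ∑ⱼ aᵢⱼ (uᵢ - uⱼ) + G (∑ⱼ aᵢⱼ (yᵢ - yⱼ) - C₁ wᵢ)`, `uᵢ = F wᵢ`,
under the disturbances `d`. -/
structure IsNetworkTrajectory (S : LinSys n m q r p) (Γ : WeightedGraph N)
    (F : Matrix (Fin m) (Fin n) ℝ) (G : Matrix (Fin n) (Fin r) ℝ)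
    (d : Fin N → ℝ → Fin q → ℝ) (x w : Fin N → ℝ → Fin n → ℝ)
    (u : Fin N → ℝ → Fin m → ℝ) (y : Fin N → ℝ → Fin r → ℝ) : Prop where
  state : ∀ i, ∀ t, 0 ≤ t →
    HasDerivWithinAt (x i) (S.A *ᵥ x i t + S.B *ᵥ u i t + S.E *ᵥ d i t) (Set.Ici 0) t
  measurement : ∀ i, ∀ t, 0 ≤ t → y i t = S.C₁ *ᵥ x i t + S.D₁ *ᵥ d i t
  observer : ∀ i, ∀ t, 0 ≤ t →
    HasDerivWithinAt (w i)
      (S.A *ᵥ w i t + S.B *ᵥ (∑ j, Γ.a i j • (u i t - u j t))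
        + G *ᵥ ((∑ j, Γ.a i j • (y i t - y j t)) - S.C₁ *ᵥ w i t)) (Set.Ici 0) t
  control : ∀ i, ∀ t, 0 ≤ t → u i t = F *ᵥ w i t

/-- The protocol with gains `F`, `G` synchronizes the network: whenever all disturbances are
zero, `xᵢ(t) - xⱼ(t) → 0` and `wᵢ(t) - wⱼ(t) → 0` as `t → ∞`, for all `i`, `j`. -/
def Synchronizes (S : LinSys n m q r p) (Γ : WeightedGraph N)
    (F : Matrix (Fin m) (Fin n) ℝ) (G : Matrix (Fin n) (Fin r) ℝ) : Prop :=
  ∀ x w u y, S.IsNetworkTrajectory Γ F G 0 x w u y → ∀ i j,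
    Tendsto (fun t => x i t - x j t) atTop (𝓝 0) ∧ Tendsto (fun t => w i t - w j t) atTop (𝓝 0)

/-- The state matrix of the controlled network, in the aggregate state `(x, w)`. -/
def networkA (S : LinSys n m q r p) (Γ : WeightedGraph N)
    (F : Matrix (Fin m) (Fin n) ℝ) (G : Matrix (Fin n) (Fin r) ℝ) :
    Matrix ((Fin N × Fin n) ⊕ (Fin N × Fin n)) ((Fin N × Fin n) ⊕ (Fin N × Fin n)) ℝ :=
  Matrix.fromBlocks
    ((1 : Matrix (Fin N) (Fin N) ℝ) ⊗ₖ S.A)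
    ((1 : Matrix (Fin N) (Fin N) ℝ) ⊗ₖ (S.B * F))
    (Γ.laplacian ⊗ₖ (G * S.C₁))
    ((1 : Matrix (Fin N) (Fin N) ℝ) ⊗ₖ (S.A - G * S.C₁) + Γ.laplacian ⊗ₖ (S.B * F))

/-- The disturbance matrix of the controlled network. -/
def networkE (S : LinSys n m q r p) (Γ : WeightedGraph N) (G : Matrix (Fin n) (Fin r) ℝ) :
    Matrix ((Fin N × Fin n) ⊕ (Fin N × Fin n)) (Fin N × Fin q) ℝ :=
  Matrix.fromRows
    ((1 : Matrix (Fin N) (Fin N) ℝ) ⊗ₖ S.E)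
    (Γ.laplacian ⊗ₖ (G * S.D₁))

/-- The matrix of the output `ζ = (W^{1/2} Rᵀ ⊗ I) z` of weighted disagreements of the controlled
network, where `W = diag(ω)`. -/
noncomputable def networkC (S : LinSys n m q r p) {K : ℕ} (R : Matrix (Fin N) (Fin K) ℝ)
    (ω : Fin K → ℝ) (F : Matrix (Fin m) (Fin n) ℝ) :
    Matrix (Fin K × Fin p) ((Fin N × Fin n) ⊕ (Fin N × Fin n)) ℝ :=
  Matrix.fromCols
    ((Matrix.diagonal (fun k => Real.sqrt (ω k)) * Rᵀ) ⊗ₖ S.C₂)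
    ((Matrix.diagonal (fun k => Real.sqrt (ω k)) * Rᵀ) ⊗ₖ (S.D₂ * F))

/-- The global `H₂` cost `J(F, G)`, from the aggregate disturbance `d` to the output `ζ`. -/
noncomputable def networkCost (S : LinSys n m q r p) (Γ : WeightedGraph N) {K : ℕ}
    (R : Matrix (Fin N) (Fin K) ℝ) (ω : Fin K → ℝ)
    (F : Matrix (Fin m) (Fin n) ℝ) (G : Matrix (Fin n) (Fin r) ℝ) : ℝ≥0∞ :=
  h2Cost (S.networkA Γ F G) (S.networkE Γ G) (S.networkC R ω F)

end LinSys

end MultiAgent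

open MultiAgent

namespace MultiAgent


/-! ### Decay of the solutions of a linear differential equation -/

/-! Diagonalize the Laplacian by an orthogonal matrix. For an eigenvector `v` with eigenvalue `l`,
the states `(v ⊗ ξ, l v ⊗ ω)` form an invariant subspace of the network, on which it acts as the
auxiliary closed loop (`networkA_mul_modeEmbedding`).

Synchronization: the null vectors of a connected Laplacian are the constants, so disagreements
vanish iff every mode orthogonal to the constants vanishes (`tendsto_sub_iff_tendsto_modes`). Each
such mode solves an auxiliary closed loop, every auxiliary solution occurs as a mode, and a matrix
is Hurwitz iff all its solutions decay (`IsHurwitz.tendsto_zero`, `isHurwitz_of_tendsto_zero`).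

Cost: the squared Frobenius norm of `T(t)` may be computed in the eigenbasis. The same intertwining
carries over to exponentials, and `‖W^{1/2} Rᵀ v‖² = vᵀ L v = l` for unit `v` accounts for the
factor `√l` in the auxiliary output. The integrands therefore agree for every `t`, so the costs
agree in `[0, ∞]` even without stability; the mode `l = 0` contributes nothing. -/

theorem tendsto_exp_mul_pow_atTop {μ : ℂ} (hμ : μ.re < 0) (j : ℕ) :
    Tendsto (fun t : ℝ => Complex.exp (t * μ) * (t : ℂ) ^ j) atTop (𝓝 0) := by
  have hs : 0 < -μ.re := by linarith
  have h := (isLittleO_pow_exp_pos_mul_atTop (k := j) hs).tendsto_div_nhds_zero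
  rw [tendsto_zero_iff_norm_tendsto_zero]
  refine (tendsto_zero_iff_norm_tendsto_zero.1 h).congr fun t => ?_
  rw [norm_div, norm_mul, Complex.norm_exp, norm_pow, norm_pow, Complex.norm_real,
    Real.norm_of_nonneg (Real.exp_pos _).le, div_eq_mul_inv, ← Real.exp_neg]
  simp [mul_comm]

/-- The orbit of a generalized eigenvector under the flow of `x' = T x`. -/
theorem exists_decaying_solution_of_mem_genEigenspace {V : Type*} [NormedAddCommGroup V]
    [NormedSpace ℂ V] (T : V →ₗ[ℂ] V) {μ : ℂ} (hμ : μ.re < 0) {k : ℕ} {v : V}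
    (hv : ((T - algebraMap ℂ (Module.End ℂ V) μ) ^ k) v = 0) :
    ∃ g : ℝ → V, g 0 = v ∧ (∀ t, HasDerivAt g (T (g t)) t) ∧ Tendsto g atTop (𝓝 0) := by
  set D : Module.End ℂ V := T - algebraMap ℂ (Module.End ℂ V) μ with hD
  have hT : ∀ x, T x = μ • x + D x := fun x => by
    simp [hD, Module.algebraMap_end_apply]
  -- One power more than needed, so that the sum below always contains the term `j = 0`, even for `k
  -- = 0`.
  have hk : (D ^ (k + 1)) v = 0 := by rw [pow_succ']; simp [hv]
  -- This is `exp(tT) v`: since `T = μ + D`, it equals `exp(tμ) exp(tD) v`, and the second series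
  -- terminates on `v`.
  refine ⟨fun t => Complex.exp (t * μ) • ∑ j ∈ Finset.range (k + 1),
    ((t : ℂ) ^ j / (j.factorial : ℂ)) • (D ^ j) v, ?_, fun t => ?_, ?_⟩
  · simp [Finset.sum_range_succ']
  · have hc : ∀ j : ℕ, HasDerivAt
        (fun s : ℝ => ((s : ℂ) ^ (j + 1) / ((j + 1).factorial : ℂ)))
        ((t : ℂ) ^ j / (j.factorial : ℂ)) t := fun j => by
      have h := ((Complex.ofRealCLM.hasDerivAt (x := t)).pow (j + 1)).div_const
        ((j + 1).factorial : ℂ)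
      have hj : ((j : ℂ) + 1) ≠ 0 := by exact_mod_cast Nat.succ_ne_zero j
      have hj' : (j.factorial : ℂ) ≠ 0 := by exact_mod_cast j.factorial_ne_zero
      convert! h using 1
      simp [Nat.factorial_succ]
      field_simp
    have he : HasDerivAt (fun s : ℝ => Complex.exp (s * μ)) (Complex.exp (t * μ) * μ) t := by
      have h := ((Complex.ofRealCLM.hasDerivAt (x := t)).mul_const μ).cexp
      simpa using h
    have hp : HasDerivAt (fun s : ℝ => ∑ j ∈ Finset.range (k + 1),
        ((s : ℂ) ^ j / (j.factorial : ℂ)) • (D ^ j) v)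
        (∑ j ∈ Finset.range k, ((t : ℂ) ^ j / (j.factorial : ℂ)) • (D ^ (j + 1)) v) t := by
      simp only [Finset.sum_range_succ' _ k, pow_zero, Nat.factorial_zero]
      exact (HasDerivAt.fun_sum fun j _ => (hc j).smul_const ((D ^ (j + 1)) v)).add_const _
    refine (he.smul hp).congr_deriv ?_
    have hDp : D (∑ j ∈ Finset.range (k + 1), ((t : ℂ) ^ j / (j.factorial : ℂ)) • (D ^ j) v) =
        ∑ j ∈ Finset.range k, ((t : ℂ) ^ j / (j.factorial : ℂ)) • (D ^ (j + 1)) v := by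
      rw [map_sum, Finset.sum_range_succ]
      simp only [map_smul, ← Module.End.mul_apply, ← pow_succ', hk, smul_zero, add_zero]
    rw [map_smul, hT, hDp, smul_add, smul_smul, add_comm]
  · simp only [Finset.smul_sum, smul_smul]
    rw [← Finset.sum_const_zero (s := Finset.range (k + 1)) (M := V)]
    refine tendsto_finsetSum _ fun j _ => ?_
    have h := ((tendsto_exp_mul_pow_atTop hμ j).div_const (j.factorial : ℂ)).smul_const
      ((D ^ j) v)
    simpa [mul_div_assoc] using h

theorem exists_decaying_solution {V : Type*} [NormedAddCommGroup V]
    [NormedSpace ℂ V] [FiniteDimensional ℂ V] (T : V →ₗ[ℂ] V)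
    (hT : ∀ μ ∈ spectrum ℂ T, μ.re < 0) (v : V) :
    ∃ g : ℝ → V, g 0 = v ∧ (∀ t, HasDerivAt g (T (g t)) t) ∧ Tendsto g atTop (𝓝 0) := by
  have hv : v ∈ ⨆ μ : ℂ, Module.End.maxGenEigenspace T μ := by
    rw [Module.End.iSup_maxGenEigenspace_eq_top]; trivial
  induction hv using Submodule.iSup_induction' with
  | mem μ x hx =>
    by_cases hx0 : x = 0
    · exact ⟨0, by simp [hx0], fun t => (hasDerivAt_const t (0 : V)).congr_deriv (map_zero T).symm,
        tendsto_const_nhds⟩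
    obtain ⟨k, hk⟩ := (Module.End.mem_maxGenEigenspace T μ x).1 hx
    refine exists_decaying_solution_of_mem_genEigenspace T (hT μ ?_) (k := k)
      (by simpa [Algebra.algebraMap_eq_smul_one] using hk)
    refine Module.End.HasEigenvalue.mem_spectrum ?_
    refine Module.End.hasEigenvalue_of_hasGenEigenvalue (k := k) fun h => hx0 ?_
    have : x ∈ Module.End.genEigenspace T μ k := (Module.End.mem_genEigenspace_nat).2 hk
    rw [h] at this
    simpa using this
  | zero =>
    exact ⟨0, rfl, fun t => (hasDerivAt_const t (0 : V)).congr_deriv (map_zero T).symm,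
      tendsto_const_nhds⟩
  | add x y _ _ hx hy =>
    obtain ⟨g, h0, hg, hg'⟩ := hx
    obtain ⟨f, h0', hf, hf'⟩ := hy
    refine ⟨fun t => g t + f t, by simp [h0, h0'], fun t => ?_, by simpa using hg'.add hf'⟩
    rw [map_add]
    exact (hg t).add (hf t)

/-- All the solutions on `[0, ∞)` of a linear differential equation with a Hurwitz state matrix
decay. -/
theorem IsHurwitz.tendsto_zero {ι : Type*} [Fintype ι] [DecidableEq ι] {M : Matrix ι ι ℝ}
    (hM : IsHurwitz M) {z : ℝ → ι → ℝ}
    (hz : ∀ t, 0 ≤ t → HasDerivWithinAt z (M *ᵥ z t) (Set.Ici 0) t) :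
    Tendsto z atTop (𝓝 0) := by
  set T := Matrix.toLin' (M.map (algebraMap ℝ ℂ)) with hTdef
  set zc : ℝ → ι → ℂ := fun t i => (z t i : ℂ) with hzc
  obtain ⟨g, hg0, hg, hg'⟩ := exists_decaying_solution T
    (fun μ hμ => hM μ (by
      rwa [hTdef, Matrix.spectrum_toLin'] at hμ)) (zc 0)
  have hzc' : ∀ t, 0 ≤ t → HasDerivWithinAt zc (T (zc t)) (Set.Ici 0) t := fun t ht => by
    rw [hasDerivWithinAt_pi]
    intro i
    have h := (hasDerivWithinAt_pi.1 (hz t ht) i).ofReal_comp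
    convert! h using 1
    simp [hTdef, hzc, Matrix.toLin'_apply, Matrix.mulVec, dotProduct]
  -- A linear vector field is Lipschitz, so the complexified solution coincides on `[0, t]` with the
  -- decaying one that has the same initial value.
  have heq : ∀ t, 0 ≤ t → zc t = g t := fun t ht => by
    refine ODE_solution_unique (v := fun _ => T)
      (K := ‖LinearMap.toContinuousLinearMap T‖₊) (a := 0) (b := t)
      (fun _ => (LinearMap.toContinuousLinearMap T).lipschitz) ?_ ?_ ?_ ?_ hg0.symm
      ⟨ht, le_rfl⟩
    · exact fun s hs => ((hzc' s hs.1).continuousWithinAt).mono fun r hr => hr.1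
    · exact fun s hs => (hzc' s hs.1).mono (Set.Ici_subset_Ici.2 hs.1)
    · exact fun s _ => (hg s).continuousAt.continuousWithinAt
    · exact fun s _ => (hg s).hasDerivWithinAt
  have hlim : Tendsto zc atTop (𝓝 0) := hg'.congr' <| by
    filter_upwards [eventually_ge_atTop 0] with t ht using (heq t ht).symm
  rw [tendsto_pi_nhds] at hlim ⊢
  exact fun i => (Complex.continuous_re.tendsto 0).comp (hlim i)

/-- A real square matrix is Hurwitz if all the solutions of its linear differential equation
decay. -/
theorem isHurwitz_of_tendsto_zero {ι : Type*} [Fintype ι] [DecidableEq ι] {M : Matrix ι ι ℝ}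
    (h : ∀ z : ℝ → ι → ℝ, (∀ t, HasDerivAt z (M *ᵥ z t) t) → Tendsto z atTop (𝓝 0)) :
    IsHurwitz M := by
  intro μ hμ
  rw [← Matrix.spectrum_toLin', ← Module.End.hasEigenvalue_iff_mem_spectrum] at hμ
  obtain ⟨v, hv⟩ := hμ.exists_hasEigenvector
  have hMv : M.map (algebraMap ℝ ℂ) *ᵥ v = μ • v := by
    simpa [Matrix.toLin'_apply] using hv.apply_eq_smul
  obtain ⟨i, hi⟩ : ∃ i, v i ≠ 0 := Function.ne_iff.1 hv.2
  have hder : ∀ (t : ℝ) (j : ι), HasDerivAt (fun s : ℝ => Complex.exp (s * μ) * v j)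
      (∑ l, (M j l : ℂ) * (Complex.exp (t * μ) * v l)) t := fun t j => by
    have h1 := (((Complex.ofRealCLM.hasDerivAt (x := t)).mul_const μ).cexp).mul_const (v j)
    refine h1.congr_deriv ?_
    have h2 : ∑ l, (M j l : ℂ) * v l = μ * v j := congrFun hMv j
    simp only [mul_left_comm _ (Complex.exp _), ← Finset.mul_sum, h2]
    simp [mul_assoc]
  -- Because `M` is real, the real and imaginary parts of `exp(tμ) v` are themselves real solutions.
  have hre : Tendsto (fun t : ℝ => (Complex.exp (t * μ) * v i).re) atTop (𝓝 0) := by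
    refine tendsto_pi_nhds.1 (h (fun t j => (Complex.exp (t * μ) * v j).re) fun t => ?_) i
    rw [hasDerivAt_pi]
    intro j
    refine (Complex.reCLM.hasFDerivAt.comp_hasDerivAt t (hder t j)).congr_deriv ?_
    simp [Matrix.mulVec, dotProduct, -Complex.mul_re, Complex.re_ofReal_mul]
  have him : Tendsto (fun t : ℝ => (Complex.exp (t * μ) * v i).im) atTop (𝓝 0) := by
    refine tendsto_pi_nhds.1 (h (fun t j => (Complex.exp (t * μ) * v j).im) fun t => ?_) i
    rw [hasDerivAt_pi]
    intro j
    refine (Complex.imCLM.hasFDerivAt.comp_hasDerivAt t (hder t j)).congr_deriv ?_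
    simp [Matrix.mulVec, dotProduct, -Complex.mul_im, Complex.im_ofReal_mul]
  have hnorm : Tendsto (fun t : ℝ => ‖Complex.exp (t * μ) * v i‖) atTop (𝓝 0) := by
    refine squeeze_zero (fun _ => norm_nonneg _)
      (fun t => Complex.norm_le_abs_re_add_abs_im _) ?_
    simpa using hre.abs.add him.abs
  -- If `μ.re ≥ 0`, then `‖exp(tμ) v i‖ ≥ ‖v i‖ > 0` for `t ≥ 0`, which excludes decay.
  by_contra hneg
  push Not at hneg
  have hpos : 0 < ‖v i‖ := norm_pos_iff.2 hi
  refine not_le.2 hpos (ge_of_tendsto hnorm ?_)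
  filter_upwards [eventually_ge_atTop 0] with t ht
  rw [norm_mul, Complex.norm_exp]
  refine le_mul_of_one_le_left hpos.le (Real.one_le_exp ?_)
  simpa using mul_nonneg ht hneg


/-! ### The spectrum of the Laplacian -/

namespace WeightedGraph

variable {N : ℕ} (Γ : WeightedGraph N)

theorem sum_laplacian_smul {E : Type*} [AddCommGroup E] [Module ℝ E] (x : Fin N → E) (i : Fin N) :
    ∑ j, Γ.laplacian i j • x j = ∑ j, Γ.a i j • (x i - x j) := by
  simp only [laplacian, Matrix.sub_apply, sub_smul, smul_sub, Finset.sum_sub_distrib,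
    Matrix.diagonal_apply, ite_smul, zero_smul, Finset.sum_ite_eq, Finset.mem_univ, if_true,
    Finset.sum_smul]

theorem laplacian_mulVec (x : Fin N → ℝ) (i : Fin N) :
    (Γ.laplacian *ᵥ x) i = ∑ j, Γ.a i j * (x i - x j) := by
  simpa [Matrix.mulVec, dotProduct] using Γ.sum_laplacian_smul x i

theorem two_mul_dotProduct_laplacian_mulVec (x : Fin N → ℝ) :
    2 * (x ⬝ᵥ Γ.laplacian *ᵥ x) = ∑ i, ∑ j, Γ.a i j * (x i - x j) ^ 2 := by
  have h1 : x ⬝ᵥ Γ.laplacian *ᵥ x = ∑ i, ∑ j, Γ.a i j * (x i * (x i - x j)) := by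
    simp only [dotProduct, laplacian_mulVec, Finset.mul_sum]
    exact Finset.sum_congr rfl fun i _ => Finset.sum_congr rfl fun j _ => by ring
  have h2 : x ⬝ᵥ Γ.laplacian *ᵥ x = ∑ i, ∑ j, Γ.a i j * (x j * (x j - x i)) := by
    rw [h1, Finset.sum_comm]
    exact Finset.sum_congr rfl fun i _ => Finset.sum_congr rfl fun j _ => by rw [Γ.symm]
  rw [two_mul]
  nth_rw 1 [h1]
  rw [h2, ← Finset.sum_add_distrib]
  refine Finset.sum_congr rfl fun i _ => ?_
  rw [← Finset.sum_add_distrib]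
  exact Finset.sum_congr rfl fun j _ => by ring

theorem dotProduct_laplacian_mulVec_nonneg (x : Fin N → ℝ) : 0 ≤ x ⬝ᵥ Γ.laplacian *ᵥ x := by
  have h : 0 ≤ ∑ i, ∑ j, Γ.a i j * (x i - x j) ^ 2 := Finset.sum_nonneg fun i _ =>
    Finset.sum_nonneg fun j _ => mul_nonneg (Γ.nonneg i j) (sq_nonneg _)
  linarith [Γ.two_mul_dotProduct_laplacian_mulVec x]

variable {Γ}

/-- A vanishing sum of nonnegative terms forces equal values across each edge, hence along every
walk. -/
theorem eq_of_dotProduct_laplacian_mulVec_eq_zero (hconn : Γ.toSimpleGraph.Connected)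
    {x : Fin N → ℝ} (hx : x ⬝ᵥ Γ.laplacian *ᵥ x = 0) (i j : Fin N) : x i = x j := by
  have h : ∑ i, ∑ j, Γ.a i j * (x i - x j) ^ 2 = 0 := by
    rw [← two_mul_dotProduct_laplacian_mulVec, hx, mul_zero]
  have hnn : ∀ i j, 0 ≤ Γ.a i j * (x i - x j) ^ 2 := fun i j =>
    mul_nonneg (Γ.nonneg i j) (sq_nonneg _)
  have hadj : ∀ i j, Γ.toSimpleGraph.Adj i j → x i = x j := fun i j hij => by
    have h1 := (Finset.sum_eq_zero_iff_of_nonneg fun i _ =>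
      Finset.sum_nonneg fun j _ => hnn i j).1 h i (Finset.mem_univ i)
    have h2 := (Finset.sum_eq_zero_iff_of_nonneg fun j _ => hnn i j).1 h1 j (Finset.mem_univ j)
    have h3 : Γ.a i j ≠ 0 := (show 0 < Γ.a i j from hij).ne'
    exact sub_eq_zero.1 (pow_eq_zero_iff two_ne_zero |>.1 ((mul_eq_zero.1 h2).resolve_left h3))
  obtain ⟨p⟩ := hconn.preconnected i j
  induction p with
  | nil => rfl
  | cons hd _ ih => exact (hadj _ _ hd).trans ih

/-- The quadratic form of the Laplacian is the weighted sum of the squared differences along the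
edges. -/
theorem IsIncidence.sum_mul_sq {K : ℕ} {R : Matrix (Fin N) (Fin K) ℝ} {ω : Fin K → ℝ}
    (hR : Γ.IsIncidence R ω) (x : Fin N → ℝ) :
    ∑ k, ω k * ((Rᵀ *ᵥ x) k) ^ 2 = x ⬝ᵥ Γ.laplacian *ᵥ x := by
  obtain ⟨e, he⟩ := hR
  -- Squaring removes the arbitrary orientation of the edge.
  have hval : ∀ k i j, (e k : Sym2 (Fin N)) = s(i, j) →
      Γ.a i j * (x i - x j) ^ 2 = ω k * ((Rᵀ *ᵥ x) k) ^ 2 := by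
    intro k i j hk
    obtain ⟨i', j', hk', hi, hj, h0, hω⟩ := he k
    have hne : i' ≠ j' := fun h => by
      rw [h, hj] at hi
      norm_num at hi
    have hRx : (Rᵀ *ᵥ x) k = x i' - x j' := by
      simp only [Matrix.mulVec, dotProduct, Matrix.transpose_apply]
      rw [Fintype.sum_eq_add i' j' hne fun l hl => by rw [h0 l hl.1 hl.2, zero_mul], hi, hj]
      ring
    rw [hRx, hω]
    rcases Sym2.eq_iff.1 (hk.symm.trans hk') with ⟨rfl, rfl⟩ | ⟨rfl, rfl⟩
    · rfl
    · rw [Γ.symm]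
      ring
  have hpair : ∀ i j, Γ.a i j * (x i - x j) ^ 2 =
      ∑ k, if (e k : Sym2 (Fin N)) = s(i, j) then ω k * ((Rᵀ *ᵥ x) k) ^ 2 else 0 := by
    intro i j
    by_cases hij : Γ.toSimpleGraph.Adj i j
    · obtain ⟨k, hk⟩ := e.surjective ⟨s(i, j), hij⟩
      have hk' : (e k : Sym2 (Fin N)) = s(i, j) := by rw [hk]
      rw [Finset.sum_eq_single k, if_pos hk', hval k i j hk']
      · intro l _ hl
        refine if_neg fun h => hl (e.injective (Subtype.ext (h.trans hk'.symm)))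
      · simp
    · have ha : Γ.a i j = 0 := le_antisymm (not_lt.1 hij) (Γ.nonneg i j)
      rw [ha, zero_mul, Finset.sum_eq_zero]
      intro k _
      refine if_neg fun h => hij ?_
      have := (e k).2
      rwa [h] at this
  -- Each edge arises from exactly two ordered pairs, which cancels the factor 2 in the quadratic
  -- form.
  have hcount : ∀ k, ∑ i, ∑ j, (if (e k : Sym2 (Fin N)) = s(i, j) then
      ω k * ((Rᵀ *ᵥ x) k) ^ 2 else 0) = 2 * (ω k * ((Rᵀ *ᵥ x) k) ^ 2) := by
    intro k
    obtain ⟨i', j', hk', hi, hj, -, -⟩ := he k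
    have hne : i' ≠ j' := fun h => by
      rw [h, hj] at hi
      norm_num at hi
    rw [Fintype.sum_eq_add i' j' hne, Fintype.sum_eq_single j', Fintype.sum_eq_single i',
      if_pos hk', if_pos (hk'.trans Sym2.eq_swap), two_mul]
    · intro i hi
      exact if_neg fun h => by
        rcases Sym2.eq_iff.1 (hk'.symm.trans h) with ⟨_, h⟩ | ⟨h, _⟩
        · exact hne (by simp_all)
        · exact hi h.symm
    · intro j hj
      exact if_neg fun h => by
        rcases Sym2.eq_iff.1 (hk'.symm.trans h) with ⟨_, h⟩ | ⟨h, h'⟩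
        · exact hj h.symm
        · exact hne h'.symm
    · intro i hi
      refine Finset.sum_eq_zero fun j _ => if_neg fun h => ?_
      rcases Sym2.eq_iff.1 (hk'.symm.trans h) with ⟨h, _⟩ | ⟨_, h⟩
      · exact hi.1 h.symm
      · exact hi.2 h.symm
  have h2 := Γ.two_mul_dotProduct_laplacian_mulVec x
  simp only [hpair] at h2
  rw [Finset.sum_congr rfl fun i _ => Finset.sum_comm, Finset.sum_comm,
    Finset.sum_congr rfl fun k _ => hcount k, ← Finset.mul_sum] at h2
  linarith

end WeightedGraph

/-! ### Orthonormal eigenvectors of the Laplacian -/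

variable {N : ℕ}

theorem sum_col_mul_col {U : Matrix (Fin N) (Fin N) ℝ}
    (hU : U ∈ Matrix.orthogonalGroup (Fin N) ℝ) (k l : Fin N) :
    ∑ j, U j k * U j l = if k = l then 1 else 0 := by
  have h := congrFun (congrFun ((Matrix.mem_orthogonalGroup_iff' _ _).1 hU) k) l
  simpa [Matrix.mul_apply, Matrix.one_apply] using h

theorem sum_row_mul_row {U : Matrix (Fin N) (Fin N) ℝ}
    (hU : U ∈ Matrix.orthogonalGroup (Fin N) ℝ) (i j : Fin N) :
    ∑ k, U i k * U j k = if i = j then 1 else 0 := by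
  have h := congrFun (congrFun ((Matrix.mem_orthogonalGroup_iff _ _).1 hU) i) j
  simpa [Matrix.mul_apply, Matrix.one_apply] using h

theorem mulVec_col {M U : Matrix (Fin N) (Fin N) ℝ} {lam : Fin N → ℝ}
    (hU : U ∈ Matrix.orthogonalGroup (Fin N) ℝ) (h : Uᵀ * M * U = Matrix.diagonal lam)
    (k : Fin N) : M *ᵥ U.col k = lam k • U.col k := by
  have hUU : U * Uᵀ = 1 := (Matrix.mem_orthogonalGroup_iff _ _).1 hU
  have h1 : M * U = U * Matrix.diagonal lam := by
    rw [← h, ← Matrix.mul_assoc, ← Matrix.mul_assoc, hUU, Matrix.one_mul]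
  ext i
  have h2 := congrFun (congrFun h1 i) k
  rw [Matrix.mul_diagonal] at h2
  simpa [Matrix.mul_apply, Matrix.mulVec, dotProduct, mul_comm] using h2

theorem eigenvalue_eq_quadraticForm {M U : Matrix (Fin N) (Fin N) ℝ} {lam : Fin N → ℝ}
    (hU : U ∈ Matrix.orthogonalGroup (Fin N) ℝ) (h : Uᵀ * M * U = Matrix.diagonal lam)
    (k : Fin N) : U.col k ⬝ᵥ M *ᵥ U.col k = lam k := by
  have h1 := sum_col_mul_col hU k k
  rw [if_pos rfl] at h1
  rw [mulVec_col hU h, dotProduct_smul, smul_eq_mul]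
  simp only [dotProduct, Matrix.col_apply, h1, mul_one]

theorem WeightedGraph.sum_laplacian_mulVec (Γ : WeightedGraph N) (x : Fin N → ℝ) :
    ∑ i, (Γ.laplacian *ᵥ x) i = 0 := by
  have h : ∑ i, (Γ.laplacian *ᵥ x) i = -∑ i, (Γ.laplacian *ᵥ x) i := by
    simp only [Γ.laplacian_mulVec]
    conv_lhs => rw [Finset.sum_comm]
    simp only [← Finset.sum_neg_distrib]
    exact Finset.sum_congr rfl fun i _ => Finset.sum_congr rfl fun j _ => by
      rw [Γ.symm j i]; ring
  linarith

section Spectrum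

variable {Γ : WeightedGraph N} {lam : Fin N → ℝ} {U : Matrix (Fin N) (Fin N) ℝ}

theorem eigenvalue_nonneg (hU : U ∈ Matrix.orthogonalGroup (Fin N) ℝ)
    (h : Uᵀ * Γ.laplacian * U = Matrix.diagonal lam) (k : Fin N) : 0 ≤ lam k := by
  rw [← eigenvalue_eq_quadraticForm hU h]
  exact Γ.dotProduct_laplacian_mulVec_nonneg _

theorem sum_col_eq_zero (hU : U ∈ Matrix.orthogonalGroup (Fin N) ℝ)
    (h : Uᵀ * Γ.laplacian * U = Matrix.diagonal lam) {k : Fin N} (hk : lam k ≠ 0) :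
    ∑ j, U j k = 0 := by
  have h1 := Γ.sum_laplacian_mulVec (U.col k)
  rw [mulVec_col hU h] at h1
  simp only [Pi.smul_apply, smul_eq_mul, ← Finset.mul_sum, Matrix.col_apply] at h1
  exact (mul_eq_zero.1 h1).resolve_left hk

/-- Otherwise monotonicity makes all eigenvalues positive, so every column of `U` sums to zero. Then
`Uᵀ` annihilates the all-ones vector, contrary to `U Uᵀ = 1`. -/
theorem eigenvalue_eq_zero (hlam : Monotone lam) (hU : U ∈ Matrix.orthogonalGroup (Fin N) ℝ)
    (h : Uᵀ * Γ.laplacian * U = Matrix.diagonal lam) {i : Fin N} (hi : (i : ℕ) = 0) :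
    lam i = 0 := by
  by_contra hne
  have hall : ∀ k, lam k ≠ 0 := fun k => by
    have h1 := hlam (show i ≤ k from Fin.le_def.2 (by omega))
    have h2 := lt_of_le_of_ne (eigenvalue_nonneg hU h i) (Ne.symm hne)
    linarith
  have h1 : ∑ j, ∑ k, U i k * U j k = 0 := by
    rw [Finset.sum_comm]
    simp only [← Finset.mul_sum, sum_col_eq_zero hU h (hall _), mul_zero, Finset.sum_const_zero]
  simp [sum_row_mul_row hU] at h1

theorem col_eq_of_eigenvalue_eq_zero (hconn : Γ.toSimpleGraph.Connected)
    (hU : U ∈ Matrix.orthogonalGroup (Fin N) ℝ)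
    (h : Uᵀ * Γ.laplacian * U = Matrix.diagonal lam) {k : Fin N} (hk : lam k = 0) (i j : Fin N) :
    U i k = U j k :=
  WeightedGraph.eq_of_dotProduct_laplacian_mulVec_eq_zero hconn (x := U.col k)
    (by rw [eigenvalue_eq_quadraticForm hU h, hk]) i j

/-- A second zero eigenvalue would give two constant columns, with values `a` and `b`, that are both
orthogonal and of unit length: `1 = (N a²)(N b²) = (N a b)² = 0`. -/
theorem eigenvalue_pos (hconn : Γ.toSimpleGraph.Connected) (hlam : Monotone lam)
    (hU : U ∈ Matrix.orthogonalGroup (Fin N) ℝ)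
    (h : Uᵀ * Γ.laplacian * U = Matrix.diagonal lam) {k : Fin N} (hk : 1 ≤ (k : ℕ)) :
    0 < lam k := by
  refine lt_of_le_of_ne (eigenvalue_nonneg hU h k) fun hk0 => ?_
  set o : Fin N := ⟨0, by omega⟩
  have ho : lam o = 0 := eigenvalue_eq_zero hlam hU h rfl
  have hne : o ≠ k := fun hok => by
    have : (k : ℕ) = 0 := by rw [← hok]
    omega
  have h1 := sum_col_mul_col hU o k
  have h2 := sum_col_mul_col hU o o
  have h3 := sum_col_mul_col hU k k
  rw [if_neg hne] at h1
  rw [if_pos rfl] at h2 h3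
  have hc : ∀ j, U j o = U o o := fun j => col_eq_of_eigenvalue_eq_zero hconn hU h ho j o
  have hc' : ∀ j, U j k = U o k := fun j => col_eq_of_eigenvalue_eq_zero hconn hU h hk0.symm j o
  simp only [hc, hc', Finset.sum_const, nsmul_eq_mul] at h1 h2 h3
  have : (1 : ℝ) * 1 = 0 := by
    nth_rw 1 [← h2]
    rw [← h3, mul_mul_mul_comm, mul_mul_mul_comm (U o o), ← mul_mul_mul_comm]
    linear_combination ((Finset.univ : Finset (Fin N)).card : ℝ) * (U o o * U o k) * h1
  norm_num at this

end Spectrum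


/-! ### The decomposition of the cost -/

/-- The relation passes to all powers and then to the exponential series term by term; `Q` may be
rectangular, so this is more than invariance under conjugation. -/
theorem exp_mul_of_intertwine {ι κ : Type*} [Fintype ι] [DecidableEq ι] [Fintype κ]
    [DecidableEq κ] {A : Matrix ι ι ℝ} {B : Matrix κ κ ℝ} {Q : Matrix ι κ ℝ}
    (h : A * Q = Q * B) : NormedSpace.exp A * Q = Q * NormedSpace.exp B := by
  have hpow : ∀ n : ℕ, A ^ n * Q = Q * B ^ n := fun n => by
    induction n with
    | zero => simp
    | succ n ih => rw [pow_succ, Matrix.mul_assoc, h, ← Matrix.mul_assoc, ih, Matrix.mul_assoc,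
        ← pow_succ]
  have hA : HasSum (fun n : ℕ => ((n.factorial : ℝ)⁻¹) • A ^ n) (NormedSpace.exp A) := by
    open scoped Matrix.Norms.Operator in exact NormedSpace.exp_series_hasSum_exp' (𝕂 := ℝ) A
  have hB : HasSum (fun n : ℕ => ((n.factorial : ℝ)⁻¹) • B ^ n) (NormedSpace.exp B) := by
    open scoped Matrix.Norms.Operator in exact NormedSpace.exp_series_hasSum_exp' (𝕂 := ℝ) B
  have hA' := hA.map (AddMonoidHom.mk' (fun X : Matrix ι ι ℝ => X * Q)
    fun X Y => Matrix.add_mul X Y Q) (continuous_id.matrix_mul continuous_const)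
  have hB' := hB.map (AddMonoidHom.mk' (fun X : Matrix κ κ ℝ => Q * X)
    fun X Y => Matrix.mul_add Q X Y) (continuous_const.matrix_mul continuous_id)
  refine hA'.unique ?_
  convert! hB' using 1
  funext n
  simp [hpow]

theorem continuous_impulseResponse {ι κ θ : Type*} [Fintype ι] [DecidableEq ι]
    (A : Matrix ι ι ℝ) (E : Matrix ι κ ℝ) (C : Matrix θ ι ℝ) :
    Continuous (impulseResponse A E C) := by
  have h : Continuous fun t : ℝ => NormedSpace.exp (t • A) := by
    open scoped Matrix.Norms.Operator in
    exact (NormedSpace.exp_continuous (𝔸 := Matrix ι ι ℝ)).comp (continuous_id.smul continuous_const)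
  exact (continuous_const.matrix_mul h).matrix_mul continuous_const

/-- The Kronecker product `u ⊗ M` of a column vector `u` and a matrix `M`. -/
def colKronecker {ι α β : Type*} (u : ι → ℝ) (M : Matrix α β ℝ) : Matrix (ι × α) β ℝ :=
  Matrix.of fun p b => u p.1 * M p.2 b

section ColKronecker

variable {ι κ α β γ : Type*}

theorem kronecker_mul_colKronecker [Fintype ι] [Fintype α] (X : Matrix κ ι ℝ) (Y : Matrix γ α ℝ)
    (u : ι → ℝ) (M : Matrix α β ℝ) :
    (X ⊗ₖ Y) * colKronecker u M = colKronecker (X *ᵥ u) (Y * M) := by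
  ext p b
  simp only [Matrix.mul_apply, colKronecker, Matrix.of_apply, Matrix.kroneckerMap_apply,
    Fintype.sum_prod_type, Matrix.mulVec, dotProduct, Finset.sum_mul_sum]
  exact Finset.sum_congr rfl fun i _ => Finset.sum_congr rfl fun j _ => by ring

theorem colKronecker_mul [Fintype β] (u : ι → ℝ) (M : Matrix α β ℝ) (M' : Matrix β γ ℝ) :
    colKronecker u M * M' = colKronecker u (M * M') := by
  ext p b
  simp only [Matrix.mul_apply, colKronecker, Matrix.of_apply, Finset.mul_sum, mul_assoc]

theorem colKronecker_smul (c : ℝ) (u : ι → ℝ) (M : Matrix α β ℝ) :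
    colKronecker (c • u) M = colKronecker u (c • M) := by
  ext p b
  simp only [colKronecker, Matrix.of_apply, Pi.smul_apply, Matrix.smul_apply, smul_eq_mul]
  ring

theorem trace_colKronecker [Fintype ι] [Fintype α] [Fintype β] (u : ι → ℝ) (M : Matrix α β ℝ) :
    ((colKronecker u M)ᵀ * colKronecker u M).trace = (∑ i, u i ^ 2) * (Mᵀ * M).trace := by
  simp only [Matrix.trace, Matrix.diag_apply, Matrix.mul_apply, Matrix.transpose_apply,
    colKronecker, Matrix.of_apply, Fintype.sum_prod_type, Finset.mul_sum]
  refine Finset.sum_congr rfl fun b _ => ?_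
  rw [Finset.sum_comm]
  refine Finset.sum_congr rfl fun a _ => ?_
  rw [Finset.sum_mul]
  exact Finset.sum_congr rfl fun i _ => by ring

end ColKronecker

/-- The squared Frobenius norm of a matrix, computed in an orthonormal basis of the node space. -/
theorem trace_eq_sum_trace_colKronecker {N : ℕ} {U : Matrix (Fin N) (Fin N) ℝ}
    (hU : U ∈ Matrix.orthogonalGroup (Fin N) ℝ) {θ α : Type*} [Fintype θ] [Fintype α]
    [DecidableEq α] (T : Matrix θ (Fin N × α) ℝ) :
    (Tᵀ * T).trace = ∑ i, ((T * colKronecker (U.col i) (1 : Matrix α α ℝ))ᵀ *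
      (T * colKronecker (U.col i) (1 : Matrix α α ℝ))).trace := by
  set V : Matrix (Fin N × α) (Fin N × α) ℝ := U ⊗ₖ (1 : Matrix α α ℝ) with hV
  -- Right multiplication by the orthogonal `U ⊗ 1` preserves the Frobenius norm, and its column
  -- blocks are the matrices `colKronecker (U.col i) 1`.
  have hVV : V * Vᵀ = 1 := by
    have hUU : U * Uᵀ = 1 := (Matrix.mem_orthogonalGroup_iff _ _).1 hU
    rw [hV, ← Matrix.kroneckerMap_transpose, ← Matrix.mul_kronecker_mul, hUU, Matrix.transpose_one,
      Matrix.one_mul, Matrix.one_kronecker_one]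
  have h1 : (Tᵀ * T).trace = ((T * V)ᵀ * (T * V)).trace := by
    rw [Matrix.trace_mul_comm (T * V)ᵀ, Matrix.transpose_mul, Matrix.mul_assoc,
      ← Matrix.mul_assoc V, hVV, Matrix.one_mul, Matrix.trace_mul_comm]
  have h2 : ∀ (k : θ) (i : Fin N) (b : α), (T * V) k (i, b) =
      (T * colKronecker (U.col i) (1 : Matrix α α ℝ)) k b := fun k i b => by
    simp [Matrix.mul_apply, hV, colKronecker]
  rw [h1]
  simp only [Matrix.trace, Matrix.diag_apply, Matrix.mul_apply (M := (_)ᵀ), Matrix.transpose_apply,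
    Fintype.sum_prod_type, h2]

/-! ### Intertwining the auxiliary closed loops with the network -/

namespace LinSys

variable {n m q r p N : ℕ} (S : LinSys n m q r p)

/-- The embedding of the closed loop of the auxiliary system for the eigenvalue `l` into the
controlled network, along an eigenvector `v` of the Laplacian. -/
def modeEmbedding (n : ℕ) (v : Fin N → ℝ) (l : ℝ) :
    Matrix ((Fin N × Fin n) ⊕ (Fin N × Fin n)) (Fin n ⊕ Fin n) ℝ :=
  Matrix.fromBlocks (colKronecker v 1) 0 0 (colKronecker v (l • 1))

variable {Γ : WeightedGraph N} {v : Fin N → ℝ} {l : ℝ}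

/-- The scaling by `l` in the observer block turns the input coupling `B F` into `l B F`, and it
absorbs the `l` that the Laplacian produces in front of `G C₁`. No division by `l` occurs, so `l =
0` is allowed. -/
theorem networkA_mul_modeEmbedding (hv : Γ.laplacian *ᵥ v = l • v) (F : Matrix (Fin m) (Fin n) ℝ)
    (G : Matrix (Fin n) (Fin r) ℝ) :
    S.networkA Γ F G * modeEmbedding n v l =
      modeEmbedding n v l * (S.auxiliary l).closedA F G := by
  simp only [networkA, modeEmbedding, closedA, auxiliary, Matrix.fromBlocks_multiply,
    Matrix.add_mul, kronecker_mul_colKronecker, colKronecker_mul, hv, Matrix.one_mulVec,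
    colKronecker_smul, Matrix.mul_zero, Matrix.zero_mul, add_zero, zero_add, Matrix.mul_one,
    Matrix.one_mul, Matrix.smul_mul, Matrix.mul_smul]
  congr 1
  all_goals
    ext a b
    simp [colKronecker]
    try ring

theorem networkE_mul_colKronecker (hv : Γ.laplacian *ᵥ v = l • v) (G : Matrix (Fin n) (Fin r) ℝ) :
    S.networkE Γ G * colKronecker v (1 : Matrix (Fin q) (Fin q) ℝ) =
      modeEmbedding n v l * (S.auxiliary l).closedE G := by
  simp only [networkE, modeEmbedding, closedE, auxiliary, Matrix.fromRows_mul,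
    Matrix.fromBlocks_mul_fromRows, kronecker_mul_colKronecker, colKronecker_mul, hv,
    Matrix.one_mulVec, colKronecker_smul, Matrix.zero_mul, add_zero, zero_add, Matrix.mul_one,
    Matrix.one_mul, Matrix.smul_mul]

theorem networkC_mul_modeEmbedding {K : ℕ} (R : Matrix (Fin N) (Fin K) ℝ) (ω : Fin K → ℝ)
    (F : Matrix (Fin m) (Fin n) ℝ) :
    S.networkC R ω F * modeEmbedding n v l =
      colKronecker ((Matrix.diagonal (fun k => Real.sqrt (ω k)) * Rᵀ) *ᵥ v)
        (Matrix.fromCols S.C₂ (l • (S.D₂ * F))) := by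
  simp only [networkC, modeEmbedding, Matrix.fromCols_mul_fromBlocks, kronecker_mul_colKronecker,
    Matrix.mul_zero, add_zero, zero_add, Matrix.mul_one, Matrix.mul_smul]
  ext a (b | b) <;> simp [colKronecker]

theorem closedC_auxiliary (l : ℝ) (F : Matrix (Fin m) (Fin n) ℝ) :
    (S.auxiliary l).closedC F =
      Real.sqrt l • Matrix.fromCols S.C₂ (l • (S.D₂ * F)) := by
  ext a (b | b)
  · simp [closedC, auxiliary]
  · simp [closedC, auxiliary, Matrix.smul_mul]
    ring

end LinSys

namespace WeightedGraph

theorem IsIncidence.nonneg {N K : ℕ} {Γ : WeightedGraph N} {R : Matrix (Fin N) (Fin K) ℝ}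
    {ω : Fin K → ℝ} (hR : Γ.IsIncidence R ω) (k : Fin K) : 0 ≤ ω k := by
  obtain ⟨e, he⟩ := hR
  obtain ⟨i, j, -, -, -, -, h⟩ := he k
  exact h ▸ Γ.nonneg i j

/-- At a unit eigenvector the right side is the eigenvalue; this matches the square of the factor
`√l` extracted in `closedC_auxiliary`. -/
theorem IsIncidence.sum_sq {N K : ℕ} {Γ : WeightedGraph N} {R : Matrix (Fin N) (Fin K) ℝ}
    {ω : Fin K → ℝ} (hR : Γ.IsIncidence R ω) (x : Fin N → ℝ) :
    ∑ k, (((Matrix.diagonal (fun k => Real.sqrt (ω k)) * Rᵀ) *ᵥ x) k) ^ 2 =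
      x ⬝ᵥ Γ.laplacian *ᵥ x := by
  rw [← hR.sum_mul_sq]
  refine Finset.sum_congr rfl fun k _ => ?_
  rw [← Matrix.mulVec_mulVec, Matrix.mulVec_diagonal, mul_pow, Real.sq_sqrt (hR.nonneg k)]

end WeightedGraph

theorem trace_transpose_mul_self_nonneg {α β : Type*} [Fintype α] [Fintype β]
    (M : Matrix α β ℝ) : 0 ≤ (Mᵀ * M).trace := by
  simp only [Matrix.trace, Matrix.diag_apply, Matrix.mul_apply, Matrix.transpose_apply]
  exact Finset.sum_nonneg fun _ _ => Finset.sum_nonneg fun _ _ => mul_self_nonneg _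

namespace LinSys

variable {n m q r p N K : ℕ} (S : LinSys n m q r p)

theorem trace_impulseResponse_network {Γ : WeightedGraph N} {R : Matrix (Fin N) (Fin K) ℝ}
    {ω : Fin K → ℝ} (hR : Γ.IsIncidence R ω) {lam : Fin N → ℝ} {U : Matrix (Fin N) (Fin N) ℝ}
    (hU : U ∈ Matrix.orthogonalGroup (Fin N) ℝ) (h : Uᵀ * Γ.laplacian * U = Matrix.diagonal lam)
    (F : Matrix (Fin m) (Fin n) ℝ) (G : Matrix (Fin n) (Fin r) ℝ) (t : ℝ) :
    ((impulseResponse (S.networkA Γ F G) (S.networkE Γ G) (S.networkC R ω F) t)ᵀ *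
      impulseResponse (S.networkA Γ F G) (S.networkE Γ G) (S.networkC R ω F) t).trace =
    ∑ i, ((impulseResponse ((S.auxiliary (lam i)).closedA F G) ((S.auxiliary (lam i)).closedE G)
        ((S.auxiliary (lam i)).closedC F) t)ᵀ *
      impulseResponse ((S.auxiliary (lam i)).closedA F G) ((S.auxiliary (lam i)).closedE G)
        ((S.auxiliary (lam i)).closedC F) t).trace := by
  rw [trace_eq_sum_trace_colKronecker hU]
  refine Finset.sum_congr rfl fun i _ => ?_
  have hv := mulVec_col hU h i
  have hexp : NormedSpace.exp (t • S.networkA Γ F G) * modeEmbedding n (U.col i) (lam i) =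
      modeEmbedding n (U.col i) (lam i) * NormedSpace.exp (t • (S.auxiliary (lam i)).closedA F G) :=
    exp_mul_of_intertwine (by
      rw [Matrix.smul_mul, S.networkA_mul_modeEmbedding hv, Matrix.mul_smul])
  have hT : impulseResponse (S.networkA Γ F G) (S.networkE Γ G) (S.networkC R ω F) t *
      colKronecker (U.col i) (1 : Matrix (Fin q) (Fin q) ℝ) =
      colKronecker ((Matrix.diagonal (fun k => Real.sqrt (ω k)) * Rᵀ) *ᵥ U.col i)
        (Matrix.fromCols S.C₂ (lam i • (S.D₂ * F)) *
          NormedSpace.exp (t • (S.auxiliary (lam i)).closedA F G) *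
          (S.auxiliary (lam i)).closedE G) := by
    rw [impulseResponse, Matrix.mul_assoc, S.networkE_mul_colKronecker hv, ← Matrix.mul_assoc,
      Matrix.mul_assoc (S.networkC R ω F), hexp, ← Matrix.mul_assoc,
      S.networkC_mul_modeEmbedding, colKronecker_mul, colKronecker_mul]
  rw [hT, trace_colKronecker, hR.sum_sq, eigenvalue_eq_quadraticForm hU h, impulseResponse,
    closedC_auxiliary, Matrix.smul_mul, Matrix.smul_mul, Matrix.transpose_smul, Matrix.smul_mul,
    Matrix.mul_smul, smul_smul, Real.mul_self_sqrt (eigenvalue_nonneg hU h i), Matrix.trace_smul,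
    smul_eq_mul]

/-- The integrands agree pointwise and are nonnegative and measurable, so sum and integral commute
whether or not they are finite. -/
theorem networkCost_eq_sum {Γ : WeightedGraph N} {R : Matrix (Fin N) (Fin K) ℝ}
    {ω : Fin K → ℝ} (hR : Γ.IsIncidence R ω) {lam : Fin N → ℝ} {U : Matrix (Fin N) (Fin N) ℝ}
    (hU : U ∈ Matrix.orthogonalGroup (Fin N) ℝ) (h : Uᵀ * Γ.laplacian * U = Matrix.diagonal lam)
    (F : Matrix (Fin m) (Fin n) ℝ) (G : Matrix (Fin n) (Fin r) ℝ) :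
    S.networkCost Γ R ω F G = ∑ i, (S.auxiliary (lam i)).cost F G := by
  simp only [networkCost, cost, h2Cost]
  rw [← lintegral_finsetSum]
  · refine lintegral_congr fun t => ?_
    rw [S.trace_impulseResponse_network hR hU h,
      ENNReal.ofReal_sum_of_nonneg fun i _ => trace_transpose_mul_self_nonneg _]
  · intro i _
    have hc := continuous_impulseResponse ((S.auxiliary (lam i)).closedA F G)
      ((S.auxiliary (lam i)).closedE G) ((S.auxiliary (lam i)).closedC F)
    exact (hc.matrix_transpose.matrix_mul hc).matrix_trace.measurable.ennreal_ofReal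

theorem cost_auxiliary_zero (F : Matrix (Fin m) (Fin n) ℝ) (G : Matrix (Fin n) (Fin r) ℝ) :
    (S.auxiliary 0).cost F G = 0 := by
  simp [cost, h2Cost, impulseResponse, closedC_auxiliary]

end LinSys


/-! ### Synchronization -/

section Modes

variable {N : ℕ} {V : Type*} [AddCommGroup V] [Module ℝ V]

theorem WeightedGraph.sum_smul_eigenvector {Γ : WeightedGraph N} {v : Fin N → ℝ} {l : ℝ}
    (hv : Γ.laplacian *ᵥ v = l • v) (i : Fin N) (c : V) :
    ∑ j, Γ.a i j • (v i • c - v j • c) = (l * v i) • c := by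
  have h : ∑ j, Γ.a i j * (v i - v j) = l * v i := by
    rw [← Γ.laplacian_mulVec, hv]; rfl
  rw [← h, Finset.sum_smul]
  exact Finset.sum_congr rfl fun j _ => by rw [← sub_smul, smul_smul]

/-- Symmetry of the Laplacian moves it from `c` onto `v`; this is what closes the equation for the
projection of a trajectory on `v`. -/
theorem WeightedGraph.sum_eigenvector_smul {Γ : WeightedGraph N} {v : Fin N → ℝ} {l : ℝ}
    (hv : Γ.laplacian *ᵥ v = l • v) (c : Fin N → V) :
    ∑ i, v i • ∑ j, Γ.a i j • (c i - c j) = l • ∑ i, v i • c i := by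
  have hsymm : ∀ i j, Γ.laplacian i j = Γ.laplacian j i := fun i j => by
    by_cases hij : i = j
    · rw [hij]
    · simp [laplacian, hij, Ne.symm hij, Γ.symm i j]
  simp only [← Γ.sum_laplacian_smul, Finset.smul_sum]
  rw [Finset.sum_comm]
  refine Finset.sum_congr rfl fun j _ => ?_
  have h : ∑ i, Γ.laplacian j i * v i = l * v j := congrFun hv j
  rw [smul_smul, ← h, Finset.sum_smul]
  exact Finset.sum_congr rfl fun i _ => by rw [smul_smul, hsymm, mul_comm]

theorem eq_sum_smul_sum_smul {U : Matrix (Fin N) (Fin N) ℝ}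
    (hU : U ∈ Matrix.orthogonalGroup (Fin N) ℝ) (c : Fin N → V) (i : Fin N) :
    c i = ∑ k, U i k • ∑ j, U j k • c j := by
  simp only [Finset.smul_sum, smul_smul]
  rw [Finset.sum_comm]
  simp only [← Finset.sum_smul, sum_row_mul_row hU, ite_smul, one_smul, zero_smul,
    Finset.sum_ite_eq, Finset.mem_univ, if_true]

end Modes

/-- Disagreements vanish asymptotically if and only if the modes orthogonal to the consensus
mode do. -/
theorem tendsto_sub_iff_tendsto_modes {N : ℕ} {V : Type*} [NormedAddCommGroup V]
    [NormedSpace ℝ V] {Γ : WeightedGraph N} (hconn : Γ.toSimpleGraph.Connected)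
    {lam : Fin N → ℝ} (hlam : Monotone lam) {U : Matrix (Fin N) (Fin N) ℝ}
    (hU : U ∈ Matrix.orthogonalGroup (Fin N) ℝ) (h : Uᵀ * Γ.laplacian * U = Matrix.diagonal lam)
    (x : Fin N → ℝ → V) :
    (∀ i j, Tendsto (fun t => x i t - x j t) atTop (𝓝 0)) ↔
      ∀ k : Fin N, 1 ≤ (k : ℕ) → Tendsto (fun t => ∑ j, U j k • x j t) atTop (𝓝 0) := by
  constructor
  · intro hx k hk
    have hs := sum_col_eq_zero hU h (eigenvalue_pos hconn hlam hU h hk).ne'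
    -- The column sums to zero, so subtracting the state of a reference agent is free; agent `k` is
    -- an arbitrary choice.
    have heq : ∀ t, ∑ j, U j k • (x j t - x k t) = ∑ j, U j k • x j t := fun t => by
      simp only [smul_sub, Finset.sum_sub_distrib, ← Finset.sum_smul, hs, zero_smul, sub_zero]
    simp only [← heq]
    rw [← Finset.sum_const_zero (s := (Finset.univ : Finset (Fin N))) (M := V)]
    exact tendsto_finsetSum _ fun j _ => by simpa using (hx j k).const_smul (U j k)
  · intro hx i j
    -- In this expansion the uncontrolled mode `k = 0` drops out, its column being constant.
    have heq : ∀ t, x i t - x j t = ∑ k, (U i k - U j k) • ∑ l, U l k • x l t := fun t => by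
      simp only [sub_smul, Finset.sum_sub_distrib]
      rw [← eq_sum_smul_sum_smul hU (fun l => x l t) i, ← eq_sum_smul_sum_smul hU (fun l => x l t) j]
    simp only [heq]
    rw [← Finset.sum_const_zero (s := (Finset.univ : Finset (Fin N))) (M := V)]
    refine tendsto_finsetSum _ fun k _ => ?_
    by_cases hk : 1 ≤ (k : ℕ)
    · simpa using (hx k hk).const_smul (U i k - U j k)
    · have hk0 := eigenvalue_eq_zero hlam hU h (show (k : ℕ) = 0 by omega)
      simp [col_eq_of_eigenvalue_eq_zero hconn hU h hk0 i j]

namespace LinSys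

variable {n m q r p N : ℕ} {S : LinSys n m q r p} {Γ : WeightedGraph N} {v : Fin N → ℝ} {l : ℝ}
  {F : Matrix (Fin m) (Fin n) ℝ} {G : Matrix (Fin n) (Fin r) ℝ}

theorem closedA_auxiliary_mulVec (ξ η : Fin n → ℝ) :
    (S.auxiliary l).closedA F G *ᵥ Sum.elim ξ η =
      Sum.elim (S.A *ᵥ ξ + l • (S.B *ᵥ F *ᵥ η))
        (G *ᵥ S.C₁ *ᵥ ξ + (S.A *ᵥ η + l • (S.B *ᵥ F *ᵥ η) - G *ᵥ S.C₁ *ᵥ η)) := by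
  simp [closedA, auxiliary, Matrix.fromBlocks_mulVec, Matrix.add_mulVec, Matrix.sub_mulVec,
    Matrix.mulVec_mulVec, Matrix.smul_mulVec]

/-- Every solution of the closed loop of the auxiliary system for an eigenvalue of the Laplacian
gives a trajectory of the network along an eigenvector. -/
theorem isNetworkTrajectory_of_eigenvector (hv : Γ.laplacian *ᵥ v = l • v)
    {z : ℝ → Fin n ⊕ Fin n → ℝ}
    (hz : ∀ t, HasDerivAt z ((S.auxiliary l).closedA F G *ᵥ z t) t) :
    S.IsNetworkTrajectory Γ F G 0 (fun i t => v i • (z t ∘ Sum.inl))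
      (fun i t => v i • l • (z t ∘ Sum.inr)) (fun i t => v i • F *ᵥ (l • (z t ∘ Sum.inr)))
      (fun i t => v i • S.C₁ *ᵥ (z t ∘ Sum.inl)) := by
  have hz' : ∀ t, HasDerivAt z (Sum.elim _ _) t := fun t =>
    (hz t).congr_deriv (by
      rw [← closedA_auxiliary_mulVec (z t ∘ Sum.inl) (z t ∘ Sum.inr), Sum.elim_comp_inl_inr])
  have hl : ∀ t, HasDerivAt (fun t => z t ∘ Sum.inl) _ t := fun t =>
    hasDerivAt_pi.2 fun a => hasDerivAt_pi.1 (hz' t) (Sum.inl a)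
  have hr : ∀ t, HasDerivAt (fun t => z t ∘ Sum.inr) _ t := fun t =>
    hasDerivAt_pi.2 fun a => hasDerivAt_pi.1 (hz' t) (Sum.inr a)
  refine ⟨fun i t _ => ?_, fun i t _ => ?_, fun i t _ => ?_, fun i t _ => ?_⟩
  · refine (((hl t).const_smul (v i)).congr_deriv ?_).hasDerivWithinAt
    simp only [Sum.elim_inl, Pi.zero_apply, Matrix.mulVec_zero, add_zero, Matrix.mulVec_smul]
    ext a
    simp
    ring
  · simp [Matrix.mulVec_smul]
  · refine ((((hr t).const_smul l).const_smul (v i)).congr_deriv ?_).hasDerivWithinAt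
    rw [WeightedGraph.sum_smul_eigenvector hv, WeightedGraph.sum_smul_eigenvector hv]
    simp only [Sum.elim_inr, Matrix.mulVec_smul, Matrix.mulVec_sub]
    ext a
    simp
    ring
  · simp [Matrix.mulVec_smul]

/-- The component of an undisturbed trajectory of the network along an eigenvector of the
Laplacian solves the closed loop of the auxiliary system. -/
theorem IsNetworkTrajectory.hasDerivWithinAt_mode (hv : Γ.laplacian *ᵥ v = l • v) (hl : l ≠ 0)
    {x w : Fin N → ℝ → Fin n → ℝ} {u : Fin N → ℝ → Fin m → ℝ} {y : Fin N → ℝ → Fin r → ℝ}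
    (h : S.IsNetworkTrajectory Γ F G 0 x w u y) {t : ℝ} (ht : 0 ≤ t) :
    HasDerivWithinAt
      (fun t => Sum.elim (∑ j, v j • x j t) (l⁻¹ • ∑ j, v j • w j t))
      ((S.auxiliary l).closedA F G *ᵥ
        Sum.elim (∑ j, v j • x j t) (l⁻¹ • ∑ j, v j • w j t)) (Set.Ici 0) t := by
  have hx := HasDerivWithinAt.fun_sum (u := Finset.univ)
    fun j _ => (h.state j t ht).const_smul (v j)
  -- The factor `l⁻¹` undoes the scaling of the observer component in the mode embedding.
  have hw := (HasDerivWithinAt.fun_sum (u := Finset.univ)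
    fun j _ => (h.observer j t ht).const_smul (v j)).const_smul l⁻¹
  have hu : ∑ j, v j • u j t = F *ᵥ ∑ j, v j • w j t := by
    rw [Matrix.mulVec_sum]
    exact Finset.sum_congr rfl fun j _ => by rw [h.control j t ht, Matrix.mulVec_smul]
  have hy : ∑ j, v j • y j t = S.C₁ *ᵥ ∑ j, v j • x j t := by
    rw [Matrix.mulVec_sum]
    exact Finset.sum_congr rfl fun j _ => by
      rw [h.measurement j t ht, Matrix.mulVec_smul]
      simp
  have hsum : ∀ {a b : ℕ} (M : Matrix (Fin a) (Fin b) ℝ) (c : Fin N → Fin b → ℝ),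
      ∑ j, v j • M *ᵥ c j = M *ᵥ ∑ j, v j • c j := fun M c => by
    rw [Matrix.mulVec_sum]
    exact Finset.sum_congr rfl fun j _ => by rw [Matrix.mulVec_smul]
  have hx' := hx.congr_deriv (g' := S.A *ᵥ (∑ j, v j • x j t) +
      l • (S.B *ᵥ F *ᵥ (l⁻¹ • ∑ j, v j • w j t))) (by
    simp only [Pi.zero_apply, Matrix.mulVec_zero, add_zero, smul_add, Finset.sum_add_distrib, hsum,
      hu, Matrix.mulVec_smul, smul_smul, mul_inv_cancel₀ hl, one_smul])
  have hw' := hw.congr_deriv (g' := G *ᵥ S.C₁ *ᵥ (∑ j, v j • x j t) +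
      (S.A *ᵥ (l⁻¹ • ∑ j, v j • w j t) + l • (S.B *ᵥ F *ᵥ (l⁻¹ • ∑ j, v j • w j t)) -
        G *ᵥ S.C₁ *ᵥ (l⁻¹ • ∑ j, v j • w j t))) (by
    simp only [smul_add (v _), Finset.sum_add_distrib, Matrix.mulVec_sub, smul_sub (v _) (G *ᵥ _),
      Finset.sum_sub_distrib, hsum, WeightedGraph.sum_eigenvector_smul hv, hu, hy]
    simp only [smul_add, smul_sub, Matrix.mulVec_smul, smul_smul, mul_inv_cancel₀ hl,
      inv_mul_cancel₀ hl, one_smul]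
    abel)
  rw [closedA_auxiliary_mulVec, hasDerivWithinAt_pi]
  rintro (a | a)
  · exact hasDerivWithinAt_pi.1 hx' a
  · exact hasDerivWithinAt_pi.1 hw' a

theorem synchronizes_iff (hconn : Γ.toSimpleGraph.Connected) {lam : Fin N → ℝ}
    (hlam : Monotone lam) {U : Matrix (Fin N) (Fin N) ℝ}
    (hU : U ∈ Matrix.orthogonalGroup (Fin N) ℝ)
    (h : Uᵀ * Γ.laplacian * U = Matrix.diagonal lam) :
    S.Synchronizes Γ F G ↔
      ∀ i : Fin N, 1 ≤ (i : ℕ) → (S.auxiliary (lam i)).InternallyStabilizes F G := by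
  constructor
  · intro hs k hk
    have hpos := eigenvalue_pos hconn hlam hU h hk
    refine isHurwitz_of_tendsto_zero fun z hz => ?_
    -- Spread an auxiliary solution over the agents along the unit column `k`; projecting back on
    -- that column recovers it, up to the factor `lam k` in the observer part.
    have htraj := isNetworkTrajectory_of_eigenvector (mulVec_col hU h k) hz
    have hs' := hs _ _ _ _ htraj
    have hx := (tendsto_sub_iff_tendsto_modes hconn hlam hU h _).1 (fun i j => (hs' i j).1) k hk
    have hw := (tendsto_sub_iff_tendsto_modes hconn hlam hU h _).1 (fun i j => (hs' i j).2) k hk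
    have h1 : ∑ j, U j k * U j k = 1 := by rw [sum_col_mul_col hU, if_pos rfl]
    simp only [Matrix.col_apply, smul_smul _ (U _ k), ← Finset.sum_smul, h1, one_smul] at hx
    simp only [Matrix.col_apply, smul_smul _ (U _ k), ← Finset.sum_smul, h1, one_smul] at hw
    have hw' := hw.const_smul (lam k)⁻¹
    simp only [smul_smul, inv_mul_cancel₀ hpos.ne', one_smul, smul_zero] at hw'
    rw [tendsto_pi_nhds] at hx hw' ⊢
    rintro (a | a)
    · exact hx a
    · exact hw' a
  · intro hs x w u y htraj
    have hmode : ∀ k : Fin N, 1 ≤ (k : ℕ) →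
        Tendsto (fun t => ∑ j, U j k • x j t) atTop (𝓝 0) ∧
        Tendsto (fun t => ∑ j, U j k • w j t) atTop (𝓝 0) := fun k hk => by
      have hne := (eigenvalue_pos hconn hlam hU h hk).ne'
      have hz := tendsto_pi_nhds.1 ((hs k hk).tendsto_zero fun t ht =>
        htraj.hasDerivWithinAt_mode (mulVec_col hU h k) hne ht)
      refine ⟨tendsto_pi_nhds.2 fun a => hz (Sum.inl a), ?_⟩
      have hw : Tendsto (fun t => (lam k)⁻¹ • ∑ j, U j k • w j t) atTop (𝓝 0) :=
        tendsto_pi_nhds.2 fun a => hz (Sum.inr a)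
      simpa [smul_smul, mul_inv_cancel₀ hne] using hw.const_smul (lam k)
    exact fun i j =>
      ⟨(tendsto_sub_iff_tendsto_modes hconn hlam hU h x).2 (fun k hk => (hmode k hk).1) i j,
        (tendsto_sub_iff_tendsto_modes hconn hlam hU h w).2 (fun k hk => (hmode k hk).2) i j⟩

end LinSys

end MultiAgent

theorem mainTheorem4 {N n m q r p K : ℕ}
    (Γ : WeightedGraph N) (hconn : Γ.toSimpleGraph.Connected)
    (R : Matrix (Fin N) (Fin K) ℝ) (ω : Fin K → ℝ) (hR : Γ.IsIncidence R ω)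
    (lam : Fin N → ℝ) (hlam : IsOrderedSpectrum Γ.laplacian lam)
    (S : LinSys n m q r p)
    (F : Matrix (Fin m) (Fin n) ℝ) (G : Matrix (Fin n) (Fin r) ℝ) :
    (S.Synchronizes Γ F G ↔
      ∀ i : Fin N, 1 ≤ (i : ℕ) → (S.auxiliary (lam i)).InternallyStabilizes F G) ∧
    S.networkCost Γ R ω F G =
      ∑ i ∈ (Finset.univ : Finset (Fin N)).filter (fun i : Fin N => 1 ≤ (i : ℕ)),
        (S.auxiliary (lam i)).cost F G := by
  obtain ⟨hmono, U, hU, h⟩ := hlam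
  refine ⟨LinSys.synchronizes_iff hconn hmono hU h, ?_⟩
  rw [S.networkCost_eq_sum hR hU h]
  -- The full sum also contains index `0`, whose eigenvalue is zero and whose auxiliary output
  -- matrix therefore vanishes.
  refine (Finset.sum_filter_of_ne fun i _ hi => ?_).symm
  by_contra hi1
  exact hi (by rw [eigenvalue_eq_zero hmono hU h (by omega), S.cost_auxiliary_zero])
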